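/- **Setting.** Let $(\Xi,d)$ be a compact metric space, $m\ge 1$, $\xi^1,\dots,\xi^m\in\Xi$, $r_0>0$, and let $\Theta\subseteq\mathbb R^n$ be compact and convex. Let $h$ be real-valued with $C_1\le h\le C_2$ on $\Theta\times\Xi$ for constants $C_1<C_2$. Suppose that for each $\theta\in\Theta$ the function $h(\theta,\cdot)$ is Lipschitz with respect to $d$, that for each $s\in\Xi$ the function $h(\cdot,s)$ is convex on an open convex set $\Omega\supseteq\Theta$, and that $B>0$ satisfies $\|\eta\|<B$ for every subgradient $\eta\in\partial_\theta h(\theta,s)$ (with respect to $\Omega$), $\theta\in\Theta$, $s\in\Xi$. Put $$\mathcal H=\{v\in\mathbb R^{m+1}: C_1\le v_i\le (m+1)C_2-mC_1\ (i\le m),\ 0\le v_{m+1}\le (C_2-C_1)/r_0\},\qquad X=\Theta\times\mathcal H,$$ and, for $x=(\theta,v)$, $f(x)=\frac1m\sum_{i=1}^m v_i+r_0v_{m+1}$ and $g_i(x,s)=h(\theta,s)-v_i-v_{m+1}d(s,\xi^i)$. Let $f^*$ be the optimal value of $$\text{(SIP)}\qquad \min\{f(x): x\in X,\ g_i(x,s)\le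 0\ \text{ for all } s\in\Xi,\ i\le m\}.$$ A point $x\in X$ is $\varepsilon$-optimal if $g_i(x,s)\le\varepsilon$ for all $s\in\Xi$ and $i\le m$, and $f(x)\le f^*$. **Algorithm.** Input: $U$ with $h<U$ on $\Theta\times\Xi$, $B$ as above, $\varepsilon>0$, $\alpha>1$. Start with $M^{(0)}=U$, $\widetilde x^{(0)}=(\theta^0,0)$ for some $\theta^0\in\Theta$, and a finite set $Q^{(0)}$ of cuts, i.e. points of $\Xi$ labelled with the iteration in which they are added (here $0$). In iteration $k=1,2,\dots$: 1. Let $(x^{(k)},w^{(k)},t^{(k)})$ be an optimal solution of the master problem: maximize $w$ subject to $t+w\le M^{(k-1)}$, $f(x)-t+Bw\le0$, $g_i(x,s)+Bw\le 0$ for all $i\le m$ and all cuts $s\in Q^{(k-1)}$, $x\in X$. 2. If $w^{(k)}=0$, stop and return $\widetilde x^{(k-1)}$. 3. For each $i$ let an oracle return $s_i^{(k)}\in\Xi$ with $g_i(x^{(k)},s_i^{(k)})\ge\sup_{s\in\Xi} g_i(x^{(k)},s)-\varepsilon$. 4. If $g_i(x^{(k)},s^{(k)}_i)>0$ for some $i$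 (feasibility cut), add to $Q^{(k-1)}$ one or more of the points $s^{(k)}_i$ having this property, with label $k$, and put $\widetilde x^{(k)}=\widetilde x^{(k-1)}$, $M^{(k)}=M^{(k-1)}$. 5. Otherwise (update step) put $\widetilde x^{(k)}=x^{(k)}$, $M^{(k)}=f(x^{(k)})$. 6. Optionally drop any cuts $s$, with label $l$, such that $w^{(l)}\ge\alpha w^{(k)}$ and $g_i(x^{(k)},s)+Bw^{(k)}<0$ for all $i$ (the value $w^{(0)}$ is arbitrary). The result is $Q^{(k)}$. **Theorem.** For every execution of the algorithm the following hold. (a) Either the algorithm stops after finitely many iterations and returns an $\varepsilon$-optimal solution of (SIP), or it generates an infinite sequence $\{\widetilde x^{(k)}\}$ each of whose accumulation points is an $\varepsilon$-optimal solution of (SIP). (b) The algorithm converges linearly in objective value between consecutive feasibility cuts. Precisely: from the first update step on, $M^{(k)}=f(\widetilde x^{(k)})$; and for every update step $k$ with $M^{(k-1)}>f^*$, $$\rho^{(k)}:=\frac{f(\widetilde x^{(k)})-f^*}{M^{(k-1)}-f^*}\le 1-\frac1{2B'+1},\qquad B'=\max\Big\{\sqrt{r_0^2+1+\tfrac1m},\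 \sqrt{B^2+L^2+1}\Big\},$$ where $L=\max\{d(s,\xi^i): s\in\Xi,\ i\le m\}$; while for every update step $k$ with $M^{(k-1)}\le f^*$ one has $f(\widetilde x^{(k)})\le f^*$. -/

import Mathlib

open Filter Topology

noncomputable section

/-- Data of a Wasserstein-robust optimization problem with `m` samples `ξ i` in the metric space
`Ξ`, decision set `Θ ⊆ ℝⁿ`, loss `h θ s`, Wasserstein radius `r₀`, and a lower and an upper bound
`C₁`, `C₂` for the loss. -/
structure WROData (n m : ℕ) (Ξ : Type*) where
  Θ : Set (EuclideanSpace ℝ (Fin n))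
  h : EuclideanSpace ℝ (Fin n) → Ξ → ℝ
  ξ : Fin m → Ξ
  r₀ : ℝ
  C₁ : ℝ
  C₂ : ℝ

/-- Decision vectors `x = [θ, v]` with `θ ∈ ℝⁿ`, `v ∈ ℝ^{m+1}`. The entries `v_1, …, v_m` are
`x.2 i.castSucc` for `i : Fin m`, and `v_{m+1}` is `x.2 (Fin.last m)`. -/
abbrev WRODecision (n m : ℕ) : Type :=
  EuclideanSpace ℝ (Fin n) × (Fin (m + 1) → ℝ)

/-- `η` is a subgradient at `θ` of the function `φ` with (open) domain `Ω`. -/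
def IsSubgradientAt {n : ℕ} (Ω : Set (EuclideanSpace ℝ (Fin n)))
    (φ : EuclideanSpace ℝ (Fin n) → ℝ) (θ η : EuclideanSpace ℝ (Fin n)) : Prop :=
  ∀ θ' ∈ Ω, φ θ + inner ℝ η (θ' - θ) ≤ φ θ'

/-- The sequences produced by the algorithm. Index `k` holds the values at the end of iteration
`k`; index `0` holds the initialization (`w 0`, `t 0`, `s 0` have no meaning and stay arbitrary).
`best k` is the best known solution, `M k` the bound used in the next master problem, `s k i` the
answer of the oracle for the `i`-th separation problem. A cut is a pair `(l, s)`: the point `s`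
together with the iteration `l` in which it was added. -/
structure CuttingTrace (n m : ℕ) (Ξ : Type*) where
  x : ℕ → WRODecision n m
  best : ℕ → WRODecision n m
  w : ℕ → ℝ
  t : ℕ → ℝ
  M : ℕ → ℝ
  s : ℕ → Fin m → Ξ
  Q : ℕ → Set (ℕ × Ξ)

namespace CuttingTrace

variable {n m : ℕ} {Ξ : Type*}

/-- Iteration `k ≥ 1` is reached: no earlier iteration stopped. -/
def Reached (τ : CuttingTrace n m Ξ) (k : ℕ) : Prop :=
  1 ≤ k ∧ ∀ j, 1 ≤ j → j < k → τ.w j ≠ 0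

/-- The algorithm stops in iteration `k` (and returns `best (k - 1)`). -/
def StopsAt (τ : CuttingTrace n m Ξ) (k : ℕ) : Prop :=
  τ.Reached k ∧ τ.w k = 0

/-- Iteration `k ≥ 1` is reached and the algorithm does not stop in it. -/
def Continues (τ : CuttingTrace n m Ξ) (k : ℕ) : Prop :=
  τ.Reached k ∧ τ.w k ≠ 0

end CuttingTrace

namespace WROData

variable {n m : ℕ} {Ξ : Type*} [MetricSpace Ξ]

/-- The polytope `H` containing the dual variables `v`. -/
def polytope (P : WROData n m Ξ) : Set (Fin (m + 1) → ℝ) :=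
  {v | (∀ i : Fin m, P.C₁ ≤ v i.castSucc ∧ v i.castSucc ≤ (m + 1) * P.C₂ - m * P.C₁) ∧
    0 ≤ v (Fin.last m) ∧ v (Fin.last m) ≤ (P.C₂ - P.C₁) / P.r₀}

/-- `X = Θ × H`. -/
def X (P : WROData n m Ξ) : Set (WRODecision n m) := P.Θ ×ˢ P.polytope

/-- The objective `f(x) = (1/m) ∑ v_i + r₀ v_{m+1}`. -/
def obj (P : WROData n m Ξ) (x : WRODecision n m) : ℝ :=
  1 / (m : ℝ) * ∑ i : Fin m, x.2 i.castSucc + P.r₀ * x.2 (Fin.last m)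

/-- The constraint functions `g_i(x, s) = h(θ, s) - v_i - v_{m+1} d(s, ξ^i)`. -/
def con (P : WROData n m Ξ) (i : Fin m) (x : WRODecision n m) (s : Ξ) : ℝ :=
  P.h x.1 s - x.2 i.castSucc - x.2 (Fin.last m) * dist s (P.ξ i)

/-- The feasible set of the semi-infinite program. -/
def feasible (P : WROData n m Ξ) : Set (WRODecision n m) :=
  {x | x ∈ P.X ∧ ∀ i s, P.con i x s ≤ 0}

/-- The optimal value of the semi-infinite program. -/
def val (P : WROData n m Ξ) : ℝ := sInf (P.obj '' P.feasible)

/-- `ε`-feasible points of the semi-infinite program. -/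
def IsEpsFeasible (P : WROData n m Ξ) (ε : ℝ) (x : WRODecision n m) : Prop :=
  x ∈ P.X ∧ ∀ i s, P.con i x s ≤ ε

/-- `ε`-optimal points of the semi-infinite program: `ε`-feasible with objective at most the
optimal value. -/
def IsEpsOptimal (P : WROData n m Ξ) (ε : ℝ) (x : WRODecision n m) : Prop :=
  P.IsEpsFeasible ε x ∧ P.obj x ≤ P.val

/-- `L`, the maximal distance of a point of `Ξ` to a sample. -/
def maxDist (P : WROData n m Ξ) : ℝ := sSup {r | ∃ (s : Ξ) (i : Fin m), r = dist s (P.ξ i)}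

/-- `B' = max {√(r₀² + 1 + 1/m), √(B² + L² + 1)}`. -/
def Bprime (P : WROData n m Ξ) (B : ℝ) : ℝ :=
  max (√(P.r₀ ^ 2 + 1 + 1 / (m : ℝ))) (√(B ^ 2 + P.maxDist ^ 2 + 1))

/-- The basic assumption (compactness of `Ξ` is a type class in the theorem). -/
structure BasicAssumption (P : WROData n m Ξ) : Prop where
  r₀_pos : 0 < P.r₀
  isCompact_Θ : IsCompact P.Θ
  bounds : ∀ θ ∈ P.Θ, ∀ s, P.C₁ ≤ P.h θ s ∧ P.h θ s ≤ P.C₂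
  bounds_lt : P.C₁ < P.C₂
  lipschitz : ∀ θ ∈ P.Θ, ∃ C > 0, ∀ s₁ s₂, |P.h θ s₁ - P.h θ s₂| ≤ C * dist s₁ s₂

/-- The convexity assumption with subgradient bound `B`. The loss is convex on an open convex set
`Ω ⊇ Θ` (possibly all of `ℝⁿ`), and its subgradients are those with respect to `Ω`; with respect
to the compact set `Θ` itself, subgradients at boundary points would never be bounded. -/
structure ConvexAssumption (P : WROData n m Ξ) (Ω : Set (EuclideanSpace ℝ (Fin n)))
    (B : ℝ) : Prop where
  convex_Θ : Convex ℝ P.Θ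
  isOpen_Ω : IsOpen Ω
  subset_Ω : P.Θ ⊆ Ω
  convexOn : ∀ s, ConvexOn ℝ Ω (fun θ => P.h θ s)
  subgradient_bound : ∀ θ ∈ P.Θ, ∀ s, ∀ η, IsSubgradientAt Ω (fun θ' => P.h θ' s) θ η → ‖η‖ < B

/-- Feasibility of `(x, w, t)` in the master problem with centering parameter `B`, bound `M` and
set of cuts `Q`. -/
def MasterFeasible (P : WROData n m Ξ) (B M : ℝ) (Q : Set (ℕ × Ξ)) (x : WRODecision n m)
    (w t : ℝ) : Prop :=
  t + w ≤ M ∧ P.obj x - t + B * w ≤ 0 ∧ (∀ c ∈ Q, ∀ i, P.con i x c.2 + B * w ≤ 0) ∧ x ∈ P.X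

/-- `(x, w, t)` is an optimal solution of the master problem (maximize `w`). -/
def IsMasterSolution (P : WROData n m Ξ) (B M : ℝ) (Q : Set (ℕ × Ξ)) (x : WRODecision n m)
    (w t : ℝ) : Prop :=
  P.MasterFeasible B M Q x w t ∧ ∀ x' w' t', P.MasterFeasible B M Q x' w' t' → w' ≤ w

/-- `s` is an `ε`-optimal solution of the `i`-th separation problem `max_{s ∈ Ξ} g_i(x, s)`. -/
def IsSepSolution (P : WROData n m Ξ) (ε : ℝ) (i : Fin m) (x : WRODecision n m) (s : Ξ) : Prop :=
  ∀ s', P.con i x s' ≤ P.con i x s + ε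

/-- The points returned by the oracle in iteration `k` that give a violated constraint. -/
def violated (P : WROData n m Ξ) (τ : CuttingTrace n m Ξ) (k : ℕ) : Set Ξ :=
  {s | ∃ i, s = τ.s k i ∧ 0 < P.con i (τ.x k) (τ.s k i)}

/-- Iteration `k` is executed and adds a feasibility cut. -/
def FeasibilityStep (P : WROData n m Ξ) (τ : CuttingTrace n m Ξ) (k : ℕ) : Prop :=
  τ.Continues k ∧ (P.violated τ k).Nonempty

/-- Iteration `k` is executed and, no feasibility cut being found, updates the best known
`ε`-feasible solution. -/
def UpdateStep (P : WROData n m Ξ) (τ : CuttingTrace n m Ξ) (k : ℕ) : Prop :=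
  τ.Continues k ∧ ¬ (P.violated τ k).Nonempty

/-- In iteration `k`, the set of cuts `Q'` is obtained from `Q` by dropping some (possibly none)
of the cuts `(l, s)` with `w^(l) ≥ α w^(k)` that are not binding at the master solution. -/
def DropsTo (P : WROData n m Ξ) (B α : ℝ) (τ : CuttingTrace n m Ξ) (k : ℕ)
    (Q Q' : Set (ℕ × Ξ)) : Prop :=
  Q' ⊆ Q ∧ ∀ c ∈ Q \ Q',
    α * τ.w k ≤ τ.w c.1 ∧ ∀ i, P.con i (τ.x k) c.2 + B * τ.w k < 0

/-- `τ` is a complete execution of the central cutting-surface algorithm with centering parameter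
`B`, initial bound `U`, tolerance `ε` and dropping parameter `α`: every iteration that is reached
is executed. Nothing is required of the sequences after the algorithm has stopped. -/
structure IsRun (P : WROData n m Ξ) (B U ε α : ℝ) (τ : CuttingTrace n m Ξ) : Prop where
  init_M : τ.M 0 = U
  init_x : ∃ θ₀ ∈ P.Θ, τ.x 0 = (θ₀, 0) ∧ τ.best 0 = τ.x 0
  init_Q : ∃ S : Finset Ξ, τ.Q 0 = {c | c.1 = 0 ∧ c.2 ∈ S}
  master : ∀ k, τ.Reached (k + 1) →
    P.IsMasterSolution B (τ.M k) (τ.Q k) (τ.x (k + 1)) (τ.w (k + 1)) (τ.t (k + 1))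
  separation : ∀ k, τ.Continues (k + 1) →
    ∀ i, P.IsSepSolution ε i (τ.x (k + 1)) (τ.s (k + 1) i)
  feasibility_step : ∀ k, P.FeasibilityStep τ (k + 1) →
    τ.best (k + 1) = τ.best k ∧ τ.M (k + 1) = τ.M k ∧
    ∃ A : Set Ξ, A.Nonempty ∧ A ⊆ P.violated τ (k + 1) ∧
      P.DropsTo B α τ (k + 1) (τ.Q k ∪ {c | c.1 = k + 1 ∧ c.2 ∈ A}) (τ.Q (k + 1))
  update_step : ∀ k, P.UpdateStep τ (k + 1) →
    τ.best (k + 1) = τ.x (k + 1) ∧ τ.M (k + 1) = P.obj (τ.x (k + 1)) ∧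
    P.DropsTo B α τ (k + 1) (τ.Q k) (τ.Q (k + 1))

end WROData

end

/-! Everything rests on a lower bound for `w`. Let `M` exceed the optimal value `val`. A nearly
optimal feasible point, with its `v_i` truncated at `C₂` and then raised by `B * w'`, has slack `B *
w'` in every constraint and costs at most `B * w'` more. It is a competitor in the master problem,
whence `w ≥ min ((M - val) / (2B + 1)) (m (C₂ - C₁) / B)` (`IsMasterSolution.le_w`); the second term
is the room that the polytope leaves above `C₂`.

Thus `w = 0` forces `M ≤ val < U`, so an update has occurred and `best` is `ε`-optimal. An update
lowers `M` by at least `(1 + B) w`, which gives the rate.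

In an infinite run, suppose `M` stays above some `b > val`. Then `w` is bounded away from zero, and
`M`, bounded below, permits only finitely many updates. But feasibility cuts alone cannot continue
forever: infinitely many are never dropped, and each keeps its own `x` at a fixed distance from all
later ones, contradicting compactness (`frequently_updateStep`). So `M` falls below every such `b`,
and accumulation points inherit the bound by closedness. -/

/-- A convex function on an open convex set has a subgradient at every point of the set. -/
theorem exists_isSubgradientAt {n : ℕ} {Ω : Set (EuclideanSpace ℝ (Fin n))}
    {φ : EuclideanSpace ℝ (Fin n) → ℝ} (hΩ : IsOpen Ω) (hφ : ConvexOn ℝ Ω φ)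
    {θ : EuclideanSpace ℝ (Fin n)} (hθ : θ ∈ Ω) : ∃ η, IsSubgradientAt Ω φ θ η := by
  have hopen : IsOpen {p : EuclideanSpace ℝ (Fin n) × ℝ | p.1 ∈ Ω ∧ φ p.1 < p.2} := by
    have hc : ContinuousOn (fun p : EuclideanSpace ℝ (Fin n) × ℝ => φ p.1 - p.2)
        (Prod.fst ⁻¹' Ω) :=
      ((hφ.continuousOn hΩ).comp continuousOn_fst fun _ hp => hp).sub continuousOn_snd
    have := hc.isOpen_inter_preimage (hΩ.preimage continuous_fst) (isOpen_Iio (a := (0 : ℝ)))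
    convert! this using 1
    ext p
    simp
  obtain ⟨f, hf⟩ := geometric_hahn_banach_open_point (x := (θ, φ θ)) hφ.convex_strict_epigraph
    hopen (fun h => lt_irrefl _ h.2)
  have hdec : ∀ x r, f (x, r) = f (x, 0) + r * f (0, 1) := fun x r => by
    rw [← smul_eq_mul, ← map_smul, ← map_add]
    simp
  -- The separating hyperplane is not vertical, so it can be normalized to a subgradient.
  have hneg : f (0, 1) < 0 := by
    have := hf (θ, φ θ + 1) ⟨hθ, by simp⟩
    rw [hdec, hdec θ (φ θ)] at this
    linarith
  have hle : ∀ θ' ∈ Ω, f (θ', 0) + φ θ' * f (0, 1) ≤ f (θ, 0) + φ θ * f (0, 1) := by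
    intro θ' hθ'
    refine le_of_forall_pos_le_add fun δ hδ => ?_
    have := hf (θ', φ θ' + δ / (-f (0, 1))) ⟨hθ', by
      have : 0 < δ / (-f (0, 1)) := div_pos hδ (by linarith)
      simpa using this⟩
    rw [hdec, hdec θ (φ θ)] at this
    have h2 : δ / (-f (0, 1)) * f (0, 1) = -δ := by
      rw [div_neg, neg_mul, div_mul_cancel₀ _ hneg.ne]
    linarith
  refine ⟨(InnerProductSpace.toDual ℝ _).symm
    ((-f (0, 1))⁻¹ • f.comp (ContinuousLinearMap.inl ℝ _ ℝ)), fun θ' hθ' => ?_⟩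
  rw [InnerProductSpace.toDual_symm_apply]
  have h1 : f (θ' - θ, 0) = f (θ', 0) - f (θ, 0) := by
    rw [← map_sub]
    simp
  have h2 := hle θ' hθ'
  simp only [smul_eq_mul, FunLike.coe_smul, Pi.smul_apply,
    ContinuousLinearMap.comp_apply, ContinuousLinearMap.inl_apply, h1]
  rw [← le_sub_iff_add_le', inv_mul_le_iff₀ (by linarith)]
  linarith

/-- A sequence bounded below by a positive number has, arbitrarily late, terms that are less than
`α > 1` times all the later ones. -/
theorem frequently_forall_lt_mul {w : ℕ → ℝ} {c α : ℝ} {K : ℕ} (hc : 0 < c) (hα : 1 < α)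
    (hw : ∀ k, K ≤ k → c ≤ w k) : ∃ᶠ l in atTop, ∀ k, l ≤ k → w l < α * w k := by
  rw [frequently_atTop]
  intro N
  set S := w '' Set.Ici (max N K)
  have hne : S.Nonempty := ⟨_, max N K, Set.self_mem_Ici, rfl⟩
  have hlb : c ∈ lowerBounds S := by
    rintro _ ⟨k, hk, rfl⟩
    exact hw k (le_of_max_le_right hk)
  have hI : c ≤ sInf S := le_csInf hne hlb
  obtain ⟨_, ⟨l, hl, rfl⟩, hlt⟩ := exists_lt_of_csInf_lt hne
    -- Near-minimal terms of the tail are the ones sought.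
    (show sInf S < α * sInf S by nlinarith)
  refine ⟨l, le_of_max_le_left hl, fun k hk => hlt.trans_le ?_⟩
  have : sInf S ≤ w k := csInf_le ⟨c, hlb⟩ ⟨k, le_trans hl hk, rfl⟩
  gcongr

/-- An antitone sequence bounded below decreases by at least `c > 0` only finitely often. -/
theorem eventually_sub_lt_of_antitone {M : ℕ → ℝ} (hM : Antitone M) {b c : ℝ} (hc : 0 < c)
    (hb : ∀ k, b ≤ M k) : ∀ᶠ k in atTop, M k - c < M (k + 1) := by
  have h1 := tendsto_atTop_ciInf hM ⟨b, by rintro _ ⟨k, rfl⟩; exact hb k⟩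
  have h2 := (h1.comp (tendsto_add_atTop_nat 1)).sub h1
  rw [sub_self] at h2
  filter_upwards [h2.eventually (lt_mem_nhds (show -c < 0 by linarith))] with k hk
  simp only [Function.comp] at hk
  linarith

namespace CuttingTrace

variable {n m : ℕ} {Ξ : Type*} {τ : CuttingTrace n m Ξ}

theorem Reached.mono {j k : ℕ} (h : τ.Reached (k + 1)) (hjk : j ≤ k) : τ.Reached (j + 1) :=
  ⟨by omega, fun i h1 h2 => h.2 i h1 (by omega)⟩

theorem Reached.continues {j k : ℕ} (h : τ.Reached (k + 1)) (hj : j + 1 ≤ k) :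
    τ.Continues (j + 1) :=
  ⟨h.mono (by omega), h.2 _ (by omega) (by omega)⟩

theorem exists_stopsAt_or_continues (τ : CuttingTrace n m Ξ) :
    (∃ k, τ.StopsAt (k + 1)) ∨ ∀ k, τ.Continues (k + 1) := by
  by_cases h : ∃ k, τ.w (k + 1) = 0
  · classical
    refine Or.inl ⟨Nat.find h, ⟨by omega, fun j h1 h2 => ?_⟩, Nat.find_spec h⟩
    obtain ⟨j, rfl⟩ := Nat.exists_eq_add_of_le' h1
    exact Nat.find_min h (by omega)
  · push Not at h
    refine Or.inr fun k => ⟨⟨by omega, fun j h1 _ => ?_⟩, h k⟩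
    obtain ⟨j, rfl⟩ := Nat.exists_eq_add_of_le' h1
    exact h j

end CuttingTrace

/-! ### The semi-infinite program: compactness, bounds and Slater-type points -/

namespace WROData

variable {n m : ℕ} {Ξ : Type*}

theorem sub_le_of_convexAssumption {P : WROData n m Ξ} {Ω : Set (EuclideanSpace ℝ (Fin n))}
    {B : ℝ} (hconv : P.ConvexAssumption Ω B) {θ θ' : EuclideanSpace ℝ (Fin n)} (hθ : θ ∈ P.Θ)
    (hθ' : θ' ∈ P.Θ) (s : Ξ) : P.h θ s - P.h θ' s ≤ B * ‖θ - θ'‖ := by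
  obtain ⟨η, hη⟩ := exists_isSubgradientAt hconv.isOpen_Ω (hconv.convexOn s)
    (hconv.subset_Ω hθ)
  have h1 := hη θ' (hconv.subset_Ω hθ')
  have h2 := hconv.subgradient_bound θ hθ s η hη
  have h3 := neg_le_of_abs_le (abs_real_inner_le_norm η (θ' - θ))
  rw [norm_sub_rev] at h3
  have h4 := mul_le_mul_of_nonneg_right h2.le (norm_nonneg (θ - θ'))
  simp only at h1
  linarith

theorem isCompact_polytope (P : WROData n m Ξ) : IsCompact P.polytope := by
  have : P.polytope = Set.pi Set.univ (Fin.lastCases (Set.Icc 0 ((P.C₂ - P.C₁) / P.r₀))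
      (fun _ => Set.Icc P.C₁ ((m + 1) * P.C₂ - m * P.C₁))) := by
    ext v
    simp [polytope, Fin.forall_fin_succ', Set.mem_pi]
  rw [this]
  refine isCompact_univ_pi fun i => ?_
  refine Fin.lastCases ?_ (fun i => ?_) i
  · simpa using isCompact_Icc
  · simpa using isCompact_Icc

theorem continuous_obj (P : WROData n m Ξ) : Continuous P.obj := by
  unfold obj
  fun_prop

variable [MetricSpace Ξ]

theorem isCompact_X {P : WROData n m Ξ} (hP : P.BasicAssumption) : IsCompact P.X :=
  hP.isCompact_Θ.prod P.isCompact_polytope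

theorem continuousOn_con {P : WROData n m Ξ} {Ω : Set (EuclideanSpace ℝ (Fin n))} {B : ℝ}
    (hconv : P.ConvexAssumption Ω B) (i : Fin m) (s : Ξ) :
    ContinuousOn (fun x => P.con i x s) P.X := by
  have h1 : ContinuousOn (fun x : WRODecision n m => P.h x.1 s) P.X :=
    ((hconv.convexOn s).continuousOn hconv.isOpen_Ω).comp continuousOn_fst
      fun x hx => hconv.subset_Ω hx.1
  unfold con
  fun_prop

theorem C₁_le_obj {P : WROData n m Ξ} (hm : 0 < m) (hP : P.BasicAssumption)
    {x : WRODecision n m} (hx : x ∈ P.X) : P.C₁ ≤ P.obj x := by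
  have hm' : (0 : ℝ) < m := by exact_mod_cast hm
  have h1 : (m : ℝ) * P.C₁ ≤ ∑ i : Fin m, x.2 i.castSucc := by
    simpa using Finset.sum_le_sum fun i (_ : i ∈ Finset.univ) => (hx.2.1 i).1
  have h2 := mul_nonneg hP.r₀_pos.le hx.2.2.1
  unfold obj
  rw [one_div, inv_mul_eq_div]
  have h3 : P.C₁ ≤ (∑ i : Fin m, x.2 i.castSucc) / m := by
    rw [le_div_iff₀ hm']
    linarith
  linarith

theorem obj_le {P : WROData n m Ξ} (hm : 0 < m) (hP : P.BasicAssumption)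
    {x : WRODecision n m} (hx : x ∈ P.X) :
    P.obj x ≤ P.C₁ + (m + 2) * (P.C₂ - P.C₁) := by
  have hm' : (0 : ℝ) < m := by exact_mod_cast hm
  have h1 : ∑ i : Fin m, x.2 i.castSucc ≤ m * ((m + 1) * P.C₂ - m * P.C₁) := by
    simpa [mul_sub (m : ℝ)] using
      Finset.sum_le_sum fun i (_ : i ∈ Finset.univ) => (hx.2.1 i).2
  have h2 : P.r₀ * x.2 (Fin.last m) ≤ P.C₂ - P.C₁ := by
    rw [mul_comm]
    exact (le_div_iff₀ hP.r₀_pos).1 hx.2.2.2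
  unfold obj
  rw [one_div, inv_mul_eq_div]
  have h3 : (∑ i : Fin m, x.2 i.castSucc) / m ≤ (m + 1) * P.C₂ - m * P.C₁ := by
    rw [div_le_iff₀ hm']
    linarith
  linarith

theorem bddBelow_obj {P : WROData n m Ξ} (hm : 0 < m) (hP : P.BasicAssumption) :
    BddBelow (P.obj '' P.feasible) :=
  ⟨P.C₁, by rintro _ ⟨x, hx, rfl⟩; exact C₁_le_obj hm hP hx.1⟩

theorem val_le {P : WROData n m Ξ} (hm : 0 < m) (hP : P.BasicAssumption)
    {x : WRODecision n m} (hx : x ∈ P.feasible) : P.val ≤ P.obj x :=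
  csInf_le (bddBelow_obj hm hP) ⟨x, hx, rfl⟩

theorem le_val {P : WROData n m Ξ} (hne : P.feasible.Nonempty) {b : ℝ}
    (hb : ∀ x ∈ P.feasible, b ≤ P.obj x) : b ≤ P.val :=
  le_csInf (hne.image _) (by rintro _ ⟨x, hx, rfl⟩; exact hb x hx)

/-- Take every `v_i` equal to the maximum of `h θ` and `v_{m+1} = 0`. The maximum is attained by
compactness, so the inequality stays strict; this is what separates `U` from the optimal value. -/
theorem exists_feasible_obj_lt [CompactSpace Ξ] {P : WROData n m Ξ} (hm : 0 < m)
    (hP : P.BasicAssumption) {U : ℝ} (hU : ∀ θ ∈ P.Θ, ∀ s, P.h θ s < U)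
    {θ : EuclideanSpace ℝ (Fin n)} (hθ : θ ∈ P.Θ) : ∃ x ∈ P.feasible, P.obj x < U := by
  have : Nonempty Ξ := ⟨P.ξ ⟨0, hm⟩⟩
  have hm' : (0 : ℝ) < m := by exact_mod_cast hm
  obtain ⟨C, hC, hlip⟩ := hP.lipschitz θ hθ
  have hcont : Continuous (P.h θ) :=
    (LipschitzWith.of_dist_le_mul (K := ⟨C, hC.le⟩) (f := P.h θ) hlip).continuous
  obtain ⟨s, -, hs⟩ := isCompact_univ.exists_isMaxOn Set.univ_nonempty hcont.continuousOn
  have hb := hP.bounds θ hθ s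
  have hD := hP.bounds_lt
  refine ⟨(θ, Fin.lastCases 0 fun _ => P.h θ s), ⟨⟨hθ, fun i => ?_, ?_⟩, fun i s' => ?_⟩, ?_⟩
  · simp only [Fin.lastCases_castSucc]
    exact ⟨hb.1, by nlinarith⟩
  · simp only [Fin.lastCases_last]
    exact ⟨le_rfl, div_nonneg (by linarith) hP.r₀_pos.le⟩
  · have := hs (Set.mem_univ s')
    simpa [con] using this
  · have : (m : ℝ)⁻¹ * (m * P.h θ s) = P.h θ s := by field_simp
    simpa [obj, this] using hU θ hθ s

/-- Raising the dual variables of a feasible point, after truncating them at `C₂`, gives a point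
with slack in all constraints. -/
theorem exists_slack {P : WROData n m Ξ} (hm : 0 < m) (hP : P.BasicAssumption)
    {y : WRODecision n m} (hy : y ∈ P.feasible) {δ : ℝ} (hδ : 0 ≤ δ)
    (hδ' : δ ≤ m * (P.C₂ - P.C₁)) :
    ∃ x ∈ P.X, P.obj x ≤ P.obj y + δ ∧ ∀ i s, P.con i x s ≤ -δ := by
  have hm' : (0 : ℝ) < m := by exact_mod_cast hm
  have hD := hP.bounds_lt
  obtain ⟨⟨hθ, hv, hl⟩, hc⟩ := hy
  refine ⟨(y.1, Fin.lastCases (y.2 (Fin.last m)) fun i => min (y.2 i.castSucc) P.C₂ + δ),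
    ⟨hθ, fun i => ?_, ?_⟩, ?_, fun i s => ?_⟩
  · simp only [Fin.lastCases_castSucc]
    constructor
    · have := le_min (hv i).1 hD.le
      linarith
    · have := min_le_right (y.2 i.castSucc) P.C₂
      linarith
  · simpa only [Fin.lastCases_last] using hl
  · simp only [obj, Fin.lastCases_castSucc, Fin.lastCases_last, Finset.sum_add_distrib,
      Finset.sum_const, Finset.card_univ, Fintype.card_fin, nsmul_eq_mul, mul_add]
    have h1 : 1 / (m : ℝ) * (m * δ) = δ := by field_simp
    have h2 : 1 / (m : ℝ) * ∑ i : Fin m, min (y.2 i.castSucc) P.C₂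
        ≤ 1 / (m : ℝ) * ∑ i : Fin m, y.2 i.castSucc := by
      gcongr with i
      exact min_le_left _ _
    linarith
  · have h1 := hc i s
    have h2 := (hP.bounds y.1 hθ s).2
    have h3 := mul_nonneg hl.1 (dist_nonneg (x := s) (y := P.ξ i))
    simp only [con, Fin.lastCases_castSucc, Fin.lastCases_last] at h1 ⊢
    have : P.h y.1 s - y.2 (Fin.last m) * dist s (P.ξ i) ≤ min (y.2 i.castSucc) P.C₂ :=
      le_min (by linarith) (by linarith)
    linarith

/-! ### Estimates for solutions of the master problem -/

section Master

variable {P : WROData n m Ξ} {B M : ℝ} {Q : Set (ℕ × Ξ)} {x : WRODecision n m} {w t : ℝ}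

theorem IsMasterSolution.obj_le (h : P.IsMasterSolution B M Q x w t) :
    P.obj x ≤ M - (1 + B) * w := by
  obtain ⟨⟨h1, h2, -⟩, -⟩ := h
  linarith

theorem IsMasterSolution.le_w (h : P.IsMasterSolution B M Q x w t) (hm : 0 < m)
    (hP : P.BasicAssumption) (hB : 0 < B) (hne : P.feasible.Nonempty) (hM : P.val < M) :
    min ((M - P.val) / (2 * B + 1)) (m * (P.C₂ - P.C₁) / B) ≤ w := by
  by_contra! hlt
  have hD := hP.bounds_lt
  set D := m * (P.C₂ - P.C₁) / B with hDdef
  have hm' : (0 : ℝ) < m := by exact_mod_cast hm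
  have hDpos : 0 < D := div_pos (mul_pos hm' (by linarith)) hB
  have hBD : B * D = m * (P.C₂ - P.C₁) := by rw [hDdef]; field_simp
  obtain ⟨w', hw', h0', hwD, hlt⟩ :
      -- The competitor needs `w' ≥ 0` for a nonnegative slack, whereas `w` is not yet known to be
      -- nonnegative.
      ∃ w', w < w' ∧ 0 ≤ w' ∧ w' ≤ D ∧ w' * (2 * B + 1) < M - P.val := by
    rcases lt_or_ge w 0 with hw | hw
    · exact ⟨0, hw, le_rfl, hDpos.le, by linarith⟩
    · obtain ⟨w', h3, h4⟩ := exists_between hlt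
      obtain ⟨h5, h6⟩ := lt_min_iff.1 h4
      exact ⟨w', h3, by linarith, h6.le, by rwa [lt_div_iff₀ (by linarith)] at h5⟩
  have : M - w' * (2 * B + 1) ≤ P.val := by
    refine le_val hne fun y hy => ?_
    by_contra! hy'
    obtain ⟨x', hx', ho, hc⟩ := exists_slack hm hP hy (δ := B * w') (by positivity)
      (by rw [← hBD]; gcongr)
    have := h.2 x' w' (M - w') ⟨by linarith, by linarith, fun c _ i => by
      have := hc i c.2
      linarith, hx'⟩
    linarith
  linarith

/-- Any feasible `y` competes with the nonpositive value `w' = (M - P.obj y) / (1 + B)`, which makes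
both objective constraints tight. Optimality of `w` then turns `IsMasterSolution.obj_le` into `P.obj
x ≤ P.obj y`. -/
theorem IsMasterSolution.obj_le_val (h : P.IsMasterSolution B M Q x w t)
    (hm : 0 < m) (hP : P.BasicAssumption) (hB : 0 < B) (hne : P.feasible.Nonempty)
    (hM : M ≤ P.val) : P.obj x ≤ P.val := by
  refine le_val hne fun y hy => ?_
  have hy' := val_le hm hP hy
  have h3 : (M - P.obj y) / (1 + B) ≤ 0 :=
    div_nonpos_of_nonpos_of_nonneg (by linarith) (by linarith)
  have := h.2 y ((M - P.obj y) / (1 + B)) (M - (M - P.obj y) / (1 + B))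
    ⟨by linarith, by field_simp; linarith, fun c _ i => by
      have := hy.2 i c.2
      have := mul_nonpos_of_nonneg_of_nonpos hB.le h3
      linarith, hy.1⟩
  rw [div_le_iff₀ (by linarith)] at this
  have := h.obj_le
  linarith

end Master

theorem feasibilityStep_or_updateStep (P : WROData n m Ξ) {τ : CuttingTrace n m Ξ} {k : ℕ}
    (h : τ.Continues k) : P.FeasibilityStep τ k ∨ P.UpdateStep τ k := by
  by_cases hv : (P.violated τ k).Nonempty
  · exact Or.inl ⟨h, hv⟩
  · exact Or.inr ⟨h, hv⟩

theorem isClosed_isEpsFeasible {P : WROData n m Ξ} (hP : P.BasicAssumption)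
    {Ω : Set (EuclideanSpace ℝ (Fin n))} {B : ℝ} (hconv : P.ConvexAssumption Ω B) (ε : ℝ) :
    IsClosed {x | P.IsEpsFeasible ε x} := by
  have hX := (isCompact_X hP).isClosed
  have : {x | P.IsEpsFeasible ε x} =
      P.X ∩ ⋂ (i) (s), P.X ∩ (fun x => P.con i x s) ⁻¹' Set.Iic ε := by
    ext x
    simp only [IsEpsFeasible, Set.mem_ofPred_eq, Set.mem_inter_iff, Set.mem_iInter,
      Set.mem_preimage, Set.mem_Iic]
    exact ⟨fun h => ⟨h.1, fun i s => ⟨h.1, h.2 i s⟩⟩, fun h => ⟨h.1, fun i s => (h.2 i s).2⟩⟩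
  rw [this]
  exact hX.inter (isClosed_iInter fun i => isClosed_iInter fun s =>
    (continuousOn_con hconv i s).preimage_isClosed_of_isClosed hX isClosed_Iic)

theorem DropsTo.mem_of_lt {P : WROData n m Ξ} {B α : ℝ} {τ : CuttingTrace n m Ξ} {k : ℕ}
    {Q Q' : Set (ℕ × Ξ)} (h : P.DropsTo B α τ k Q Q') {c : ℕ × Ξ} (hc : c ∈ Q)
    (hlt : τ.w c.1 < α * τ.w k) : c ∈ Q' := by
  by_contra hn
  exact (h.2 c ⟨hc, hn⟩).1.not_gt hlt

/-! ### Invariants of a run and the linear rate -/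

namespace IsRun

variable {P : WROData n m Ξ} {B U ε α : ℝ} {τ : CuttingTrace n m Ξ}

theorem isEpsFeasible_of_updateStep (hτ : P.IsRun B U ε α τ) {k : ℕ}
    (h : P.UpdateStep τ (k + 1)) : P.IsEpsFeasible ε (τ.x (k + 1)) := by
  refine ⟨(hτ.master k h.1.1).1.2.2.2, fun i s => ?_⟩
  have h1 := hτ.separation k h.1 i s
  have h2 : P.con i (τ.x (k + 1)) (τ.s (k + 1) i) ≤ 0 := by
    by_contra! hpos
    exact h.2 ⟨_, i, rfl, hpos⟩
  linarith

/-- The alternative `U` covers the time before the first update, when `best` is still the initial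
point and need not be `ε`-feasible. -/
theorem M_eq_or (hτ : P.IsRun B U ε α τ) {k : ℕ} (hk : τ.Reached (k + 1)) :
    τ.M k = U ∨ P.IsEpsFeasible ε (τ.best k) ∧ τ.M k = P.obj (τ.best k) := by
  induction k with
  | zero => exact Or.inl hτ.init_M
  | succ k ih =>
    rcases P.feasibilityStep_or_updateStep (hk.continues le_rfl) with h | h
    · obtain ⟨h1, h2, -⟩ := hτ.feasibility_step k h
      rw [h1, h2]
      exact ih (hk.mono (by omega))
    · obtain ⟨h1, h2, -⟩ := hτ.update_step k h
      rw [h1, h2]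
      exact Or.inr ⟨hτ.isEpsFeasible_of_updateStep h, rfl⟩

theorem M_eq_obj_best (hτ : P.IsRun B U ε α τ) {j k : ℕ} (hjk : j ≤ k)
    (hj : P.UpdateStep τ j) (hk : τ.Continues k) : τ.M k = P.obj (τ.best k) := by
  have step : ∀ i, P.UpdateStep τ i → τ.M i = P.obj (τ.best i) := by
    intro i h
    obtain ⟨i, rfl⟩ := Nat.exists_eq_add_of_le' h.1.1.1
    obtain ⟨h1, h2, -⟩ := hτ.update_step i h
    rw [h1, h2]
  induction k, hjk using Nat.le_induction with
  | base => exact step j hj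
  | succ k hjk ih =>
    rcases P.feasibilityStep_or_updateStep hk with h | h
    · obtain ⟨h1, h2, -⟩ := hτ.feasibility_step k h
      rw [h1, h2]
      obtain ⟨k, rfl⟩ := Nat.exists_eq_add_of_le' (hj.1.1.1.trans hjk)
      exact ih (hk.1.continues le_rfl)
    · exact step _ h

theorem feasible_nonempty_and_val_lt [CompactSpace Ξ] (hτ : P.IsRun B U ε α τ) (hm : 0 < m)
    (hP : P.BasicAssumption) (hU : ∀ θ ∈ P.Θ, ∀ s, P.h θ s < U) :
    P.feasible.Nonempty ∧ P.val < U := by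
  obtain ⟨θ, hθ, -⟩ := hτ.init_x
  obtain ⟨x, hx, hlt⟩ := exists_feasible_obj_lt hm hP hU hθ
  exact ⟨⟨x, hx⟩, (val_le hm hP hx).trans_lt hlt⟩

theorem obj_best_le_val (hτ : P.IsRun B U ε α τ) (hm : 0 < m) (hP : P.BasicAssumption)
    (hB : 0 < B) (hne : P.feasible.Nonempty) {k : ℕ} (hk : P.UpdateStep τ (k + 1))
    (hM : τ.M k ≤ P.val) : P.obj (τ.best (k + 1)) ≤ P.val := by
  rw [(hτ.update_step k hk).1]
  exact (hτ.master k hk.1.1).obj_le_val hm hP hB hne hM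

theorem le_w (hτ : P.IsRun B U ε α τ) (hm : 0 < m) (hP : P.BasicAssumption)
    (hB : 0 < B) (hne : P.feasible.Nonempty) {k : ℕ} (hk : τ.Reached (k + 1))
    (hM : P.val < τ.M k) :
    min ((τ.M k - P.val) / (2 * B + 1)) (m * (P.C₂ - P.C₁) / B) ≤ τ.w (k + 1) :=
  (hτ.master k hk).le_w hm hP hB hne hM

theorem w_pos (hτ : P.IsRun B U ε α τ) (hm : 0 < m) (hP : P.BasicAssumption)
    (hB : 0 < B) (hne : P.feasible.Nonempty) {k : ℕ} (hk : τ.Reached (k + 1))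
    (hM : P.val < τ.M k) : 0 < τ.w (k + 1) := by
  have hm' : (0 : ℝ) < m := by exact_mod_cast hm
  refine lt_of_lt_of_le (lt_min ?_ ?_) (hτ.le_w hm hP hB hne hk hM)
  · exact div_pos (by linarith) (by linarith)
  · exact div_pos (mul_pos hm' (sub_pos.2 hP.bounds_lt)) hB

theorem rate (hτ : P.IsRun B U ε α τ) (hm : 0 < m) (hP : P.BasicAssumption)
    (hB : 0 < B) (hne : P.feasible.Nonempty) {k : ℕ} (hk : P.UpdateStep τ (k + 1))
    (hM : P.val < τ.M k) :
    (P.obj (τ.best (k + 1)) - P.val) / (τ.M k - P.val) ≤ 1 - 1 / (2 * P.Bprime B + 1) := by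
  rw [(hτ.update_step k hk).1]
  have hm' : (1 : ℝ) ≤ m := by exact_mod_cast hm
  have hD := hP.bounds_lt
  have hmas := hτ.master k hk.1.1
  have hw := hmas.le_w hm hP hB hne hM
  have hw0 := hτ.w_pos hm hP hB hne hk.1.1 hM
  have ho := hmas.obj_le
  have ho' := WROData.obj_le hm hP hmas.1.2.2.2
  have hval : P.C₁ ≤ P.val := le_val hne fun x hx => C₁_le_obj hm hP hx.1
  have hB' : √(B ^ 2 + 1) ≤ P.Bprime B :=
    le_trans (Real.sqrt_le_sqrt (by nlinarith [sq_nonneg P.maxDist])) (le_max_right _ _)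
  set b := P.Bprime B
  have hb1 : 1 ≤ b := le_trans (Real.le_sqrt_of_sq_le (by nlinarith)) hB'
  -- Only `b ≥ √(B² + 1)` is needed from `B'`; the factor 3 comes from `m + 2 ≤ 3 * m`.
  have hbB : 3 ≤ 2 * b * (1 + B) / B := by
    rw [le_div_iff₀ hB]
    have h1 : B ≤ b := le_trans (Real.le_sqrt_of_sq_le (by nlinarith)) hB'
    have h2 : B ^ 2 + 1 ≤ b ^ 2 := by
      rw [← Real.sq_sqrt (show (0 : ℝ) ≤ B ^ 2 + 1 by positivity)]
      gcongr
    nlinarith [mul_nonneg hB.le (sub_nonneg.2 h1), mul_nonneg hB.le (sub_nonneg.2 hb1),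
      sq_nonneg (B - 1), sq_nonneg (b - 1)]
  set Z := τ.M k - P.val with hZ
  have hZpos : 0 < Z := by linarith
  rw [div_le_iff₀ hZpos, sub_mul, one_mul, div_mul_eq_mul_div, one_mul]
  set o := P.obj (τ.x (k + 1))
  set w := τ.w (k + 1)
  have hb2 : 0 < 2 * b + 1 := by linarith
  rcases min_le_iff.1 hw with hw | hw
  · have h1 : Z / (2 * b + 1) ≤ (1 + B) * w := by
      rw [div_le_iff₀ (by linarith)] at hw ⊢
      nlinarith [mul_nonneg hB.le hw0.le, mul_nonneg (mul_nonneg hB.le hw0.le) (sub_nonneg.2 hb1),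
        mul_nonneg hw0.le (sub_nonneg.2 hb1)]
    linarith
  -- Here the polytope limits `w`. The gap after the update is at most `(m + 2) * E`, hence at most
  -- `2 * b` times the guaranteed decrease, which again yields the ratio `2b / (2b + 1)`.
  · have h1 : m * (P.C₂ - P.C₁) * ((1 + B) / B) ≤ (1 + B) * w := by
      calc _ = (1 + B) * (m * (P.C₂ - P.C₁) / B) := by ring
        _ ≤ _ := by gcongr
    set E := P.C₂ - P.C₁
    have hE : 0 < E := by linarith
    have h2 : (m + 2) * E ≤ 2 * b * (m * E * ((1 + B) / B)) := by
      calc (m + 2) * E ≤ 3 * (m * E) := by nlinarith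
        _ ≤ 2 * b * (1 + B) / B * (m * E) := by gcongr
        _ = _ := by ring
    have h3 : o - P.val ≤ (m + 2) * E := by linarith
    have h4 : o - P.val ≤ Z - (1 + B) * w := by linarith
    have h5 : (o - P.val) * (2 * b + 1) ≤ 2 * b * Z := by nlinarith
    have h6 : o - P.val ≤ 2 * b * Z / (2 * b + 1) := by rwa [le_div_iff₀ hb2]
    have h7 : 2 * b * Z / (2 * b + 1) = Z - Z / (2 * b + 1) := by
      field_simp
      ring
    linarith

end IsRun

theorem exists_con_sub_le [CompactSpace Ξ] {P : WROData n m Ξ}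
    {Ω : Set (EuclideanSpace ℝ (Fin n))} {B : ℝ} (hB : 0 < B) (hconv : P.ConvexAssumption Ω B) :
    ∃ K > 0, ∀ x ∈ P.X, ∀ y ∈ P.X, ∀ i s, P.con i x s - P.con i y s ≤ K * dist x y := by
  obtain ⟨R, hR⟩ := Metric.isBounded_iff.1 (isCompact_univ (X := Ξ)).isBounded
  -- The three summands account for `h`, `v_i` and `v_{m+1} d(s, ξ^i)`; `R` bounds the distances in
  -- `Ξ`.
  refine ⟨B + 1 + |R|, by positivity, fun x hx y hy i s => ?_⟩
  have h1 := sub_le_of_convexAssumption hconv hx.1 hy.1 s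
  have h2 : ‖x.1 - y.1‖ ≤ dist x y := by
    rw [dist_eq_norm]
    exact norm_fst_le (x - y)
  have h3 : ∀ j, |y.2 j - x.2 j| ≤ dist x y := fun j => by
    rw [abs_sub_comm, ← Real.dist_eq]
    exact (dist_le_pi_dist x.2 y.2 j).trans (le_max_right _ _)
  have h4 : (y.2 (Fin.last m) - x.2 (Fin.last m)) * dist s (P.ξ i) ≤ dist x y * |R| := by
    calc _ ≤ |y.2 (Fin.last m) - x.2 (Fin.last m)| * dist s (P.ξ i) := by
          gcongr
          exact le_abs_self _
      _ ≤ _ := by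
          gcongr
          · exact h3 _
          · exact (hR (Set.mem_univ _) (Set.mem_univ _)).trans (le_abs_self R)
  have h5 := (le_abs_self _).trans (h3 i.castSucc)
  have h6 := mul_le_mul_of_nonneg_left h2 hB.le
  unfold con
  linarith

/-! ### Persistence of cuts and convergence of the bounds -/

namespace IsRun

variable {P : WROData n m Ξ} {B U ε α : ℝ} {τ : CuttingTrace n m Ξ}

theorem mem_Q_of_le (hτ : P.IsRun B U ε α τ) (hcont : ∀ k, τ.Continues (k + 1)) {k l : ℕ}
    (hkl : k ≤ l) {c : ℕ × Ξ} (hc : c ∈ τ.Q k) (hlt : ∀ j, k ≤ j → τ.w c.1 < α * τ.w j) :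
    c ∈ τ.Q l := by
  induction l, hkl using Nat.le_induction with
  | base => exact hc
  | succ l hkl ih =>
    rcases P.feasibilityStep_or_updateStep (hcont l) with h | h
    · obtain ⟨-, -, A, -, -, hd⟩ := hτ.feasibility_step l h
      exact hd.mem_of_lt (Or.inl ih) (hlt _ (by omega))
    · exact (hτ.update_step l h).2.2.mem_of_lt ih (hlt _ (by omega))

/-- The hypothesis on `w` protects a cut added in iteration `l + 1` from every later drop, so it
constrains all subsequent master solutions. -/
theorem exists_cut (hτ : P.IsRun B U ε α τ) (hcont : ∀ k, τ.Continues (k + 1)) {l : ℕ}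
    (hl : P.FeasibilityStep τ (l + 1)) (hlt : ∀ j, l + 1 ≤ j → τ.w (l + 1) < α * τ.w j) :
    ∃ i s, 0 < P.con i (τ.x (l + 1)) s ∧
      ∀ k, l + 1 ≤ k → P.con i (τ.x (k + 1)) s + B * τ.w (k + 1) ≤ 0 := by
  obtain ⟨-, -, A, ⟨s, hs⟩, hA, hd⟩ := hτ.feasibility_step l hl
  obtain ⟨i, rfl, hi⟩ := hA hs
  have hmem : (l + 1, τ.s (l + 1) i) ∈ τ.Q (l + 1) :=
    hd.mem_of_lt (Or.inr ⟨rfl, hs⟩) (hlt _ le_rfl)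
  exact ⟨i, _, hi, fun k hk =>
    (hτ.master k (hcont k).1).1.2.2.1 _ (hτ.mem_Q_of_le hcont hk hmem hlt) i⟩

theorem M_succ_le_of_updateStep (hτ : P.IsRun B U ε α τ) {k : ℕ}
    (hk : P.UpdateStep τ (k + 1)) : τ.M (k + 1) ≤ τ.M k - (1 + B) * τ.w (k + 1) := by
  rw [(hτ.update_step k hk).2.1]
  exact (hτ.master k hk.1.1).obj_le

theorem M_succ_le (hτ : P.IsRun B U ε α τ) (hm : 0 < m) (hP : P.BasicAssumption)
    (hB : 0 < B) (hne : P.feasible.Nonempty) {k : ℕ} (hk : τ.Continues (k + 1))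
    (hM : P.val < τ.M k) : τ.M (k + 1) ≤ τ.M k := by
  rcases P.feasibilityStep_or_updateStep hk with h | h
  · exact (hτ.feasibility_step k h).2.1.le
  · have h1 := hτ.w_pos hm hP hB hne hk.1 hM
    have h2 := hτ.M_succ_le_of_updateStep h
    nlinarith

/-- Replaces monotonicity of `M`, which is only available above the optimal value: below it `M`
might increase, but never past `P.val`. -/
theorem M_succ_le_of_le (hτ : P.IsRun B U ε α τ) (hm : 0 < m) (hP : P.BasicAssumption)
    (hB : 0 < B) (hne : P.feasible.Nonempty) {k : ℕ} (hk : τ.Continues (k + 1)) {b : ℝ}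
    (hb : P.val ≤ b) (hM : τ.M k ≤ b) : τ.M (k + 1) ≤ b := by
  rcases lt_or_ge P.val (τ.M k) with h | h
  · exact (hτ.M_succ_le hm hP hB hne hk h).trans hM
  · rcases P.feasibilityStep_or_updateStep hk with hs | hs
    · exact (hτ.feasibility_step k hs).2.1.le.trans hM
    · rw [(hτ.update_step k hs).2.1, ← (hτ.update_step k hs).1]
      exact (hτ.obj_best_le_val hm hP hB hne hs h).trans hb

/-- If `w` stays away from zero, the algorithm cannot eventually produce feasibility cuts only:
infinitely many of them would never be dropped, and their points `x` would be separated. -/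
theorem frequently_updateStep [CompactSpace Ξ] (hτ : P.IsRun B U ε α τ)
    (hP : P.BasicAssumption) {Ω : Set (EuclideanSpace ℝ (Fin n))} (hB : 0 < B)
    (hconv : P.ConvexAssumption Ω B) (hα : 1 < α) (hcont : ∀ k, τ.Continues (k + 1)) {c : ℝ}
    (hc : 0 < c) (hw : ∀ k, c ≤ τ.w (k + 1)) : ∃ᶠ k in atTop, P.UpdateStep τ (k + 1) := by
  by_contra hfin
  rw [not_frequently] at hfin
  obtain ⟨K, hK, hlip⟩ := exists_con_sub_le hB hconv
  have hmem : ∀ k, τ.x (k + 1) ∈ P.X := fun k => (hτ.master k (hcont k).1).1.2.2.2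
  have hfreq := (frequently_forall_lt_mul (w := fun k => τ.w (k + 1)) (K := 0) hc hα
    fun k _ => hw k).and_eventually hfin
  obtain ⟨φ, hφ, hgood⟩ := extraction_of_frequently_atTop hfreq
  obtain ⟨a, -, ψ, hψ, hlim⟩ := (isCompact_X hP).tendsto_subseq
    (x := fun j => τ.x (φ j + 1)) fun j => hmem _
  -- A surviving cut is positive at its own point and at most `-B * c` at later ones, so by the
  -- Lipschitz bound these points lie at least `B * c / K` apart.
  obtain ⟨N, hN⟩ := Metric.cauchySeq_iff.1 hlim.cauchySeq (B * c / K) (by positivity)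
  have hclose := hN N le_rfl (N + 1) (by omega)
  have hlt : φ (ψ N) < φ (ψ (N + 1)) := hφ (hψ (Nat.lt_succ_self N))
  simp only [Function.comp] at hclose
  set l := φ (ψ N)
  set k := φ (ψ (N + 1))
  obtain ⟨hlw, hlu⟩ := hgood (ψ N)
  obtain ⟨i, s, h1, h2⟩ := hτ.exists_cut hcont
    ((P.feasibilityStep_or_updateStep (hcont l)).resolve_right hlu) fun j hj => by
      obtain ⟨j, rfl⟩ := Nat.exists_eq_add_of_le' (show 1 ≤ j by omega)
      exact hlw j (by omega)
  have h3 := h2 k hlt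
  have h4 := hlip _ (hmem l) _ (hmem k) i s
  have h5 := mul_le_mul_of_nonneg_left (hw k) hB.le
  rw [lt_div_iff₀ hK] at hclose
  linarith

theorem exists_M_lt [CompactSpace Ξ] (hτ : P.IsRun B U ε α τ) (hm : 0 < m)
    (hP : P.BasicAssumption) {Ω : Set (EuclideanSpace ℝ (Fin n))} (hB : 0 < B)
    (hconv : P.ConvexAssumption Ω B) (hα : 1 < α) (hne : P.feasible.Nonempty)
    (hcont : ∀ k, τ.Continues (k + 1)) {b : ℝ} (hb : P.val < b) : ∃ k, τ.M k < b := by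
  by_contra! hM
  have hm' : (0 : ℝ) < m := by exact_mod_cast hm
  have hlt : ∀ k, P.val < τ.M k := fun k => hb.trans_le (hM k)
  set c := min ((b - P.val) / (2 * B + 1)) (m * (P.C₂ - P.C₁) / B)
  have hc : 0 < c := lt_min (div_pos (by linarith) (by linarith))
    (div_pos (mul_pos hm' (sub_pos.2 hP.bounds_lt)) hB)
  have hw : ∀ k, c ≤ τ.w (k + 1) := fun k => by
    refine le_trans (min_le_min_right _ ?_) (hτ.le_w hm hP hB hne (hcont k).1 (hlt k))
    have := hM k
    gcongr
  have hanti : Antitone τ.M :=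
    antitone_nat_of_succ_le fun k => hτ.M_succ_le hm hP hB hne (hcont k) (hlt k)
  obtain ⟨k, hk, hkc⟩ := ((hτ.frequently_updateStep hP hB hconv hα hcont hc hw).and_eventually
    (eventually_sub_lt_of_antitone hanti hc hM)).exists
  have h1 := hτ.M_succ_le_of_updateStep hk
  have h2 := hw k
  nlinarith

theorem isEpsOptimal_of_stopsAt (hτ : P.IsRun B U ε α τ) (hm : 0 < m)
    (hP : P.BasicAssumption) (hB : 0 < B) (hne : P.feasible.Nonempty) (hU : P.val < U) {k : ℕ}
    (hk : τ.StopsAt (k + 1)) : P.IsEpsOptimal ε (τ.best k) := by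
  have hM : τ.M k ≤ P.val := by
    by_contra! h
    exact (hτ.w_pos hm hP hB hne hk.1 h).ne' hk.2
  rcases hτ.M_eq_or hk.1 with h | ⟨h1, h2⟩
  · linarith
  · exact ⟨h1, h2 ▸ hM⟩

theorem isEpsOptimal_of_mapClusterPt [CompactSpace Ξ] (hτ : P.IsRun B U ε α τ) (hm : 0 < m)
    (hP : P.BasicAssumption) {Ω : Set (EuclideanSpace ℝ (Fin n))} (hB : 0 < B)
    (hconv : P.ConvexAssumption Ω B) (hα : 1 < α) (hne : P.feasible.Nonempty) (hU : P.val < U)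
    (hcont : ∀ k, τ.Continues (k + 1)) {y : WRODecision n m}
    (hy : MapClusterPt y atTop τ.best) : P.IsEpsOptimal ε y := by
  -- Requiring `b < U` excludes the alternative `M k = U` of `M_eq_or`, so that `best k` is
  -- eventually `ε`-feasible.
  have key : ∀ b, P.val < b → b < U → P.IsEpsFeasible ε y ∧ P.obj y ≤ b := by
    intro b hb hbU
    have hclosed : IsClosed {x | P.IsEpsFeasible ε x ∧ P.obj x ≤ b} :=
      (isClosed_isEpsFeasible hP hconv ε).inter (isClosed_le P.continuous_obj continuous_const)
    obtain ⟨K, hK⟩ := hτ.exists_M_lt hm hP hB hconv hα hne hcont hb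
    refine hclosed.mem_of_mapClusterPt hy (eventually_atTop.2 ⟨K, fun k hk => ?_⟩)
    have hM : τ.M k ≤ b := by
      induction k, hk using Nat.le_induction with
      | base => exact hK.le
      | succ k _ ih => exact hτ.M_succ_le_of_le hm hP hB hne (hcont k) hb.le ih
    rcases hτ.M_eq_or (hcont k).1 with h | ⟨h1, h2⟩
    · linarith
    · exact ⟨h1, h2 ▸ hM⟩
  obtain ⟨b, h1, h2⟩ := exists_between hU
  refine ⟨(key b h1 h2).1, le_of_forall_gt_imp_ge_of_dense fun b' hb' => ?_⟩
  exact (key _ (lt_min hb' h1) ((min_le_right b' b).trans_lt h2)).2.trans (min_le_left _ _)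

end IsRun

end WROData

theorem mainTheorem5 {n m : ℕ} (hm : 0 < m) {Ξ : Type*} [MetricSpace Ξ] [CompactSpace Ξ]
    (P : WROData n m Ξ) (hP : P.BasicAssumption)
    (Ω : Set (EuclideanSpace ℝ (Fin n))) (B : ℝ) (hB : 0 < B) (hconv : P.ConvexAssumption Ω B)
    (U : ℝ) (hU : ∀ θ ∈ P.Θ, ∀ s, P.h θ s < U)
    (ε : ℝ) (hε : 0 < ε) (α : ℝ) (hα : 1 < α)
    (τ : CuttingTrace n m Ξ) (hτ : P.IsRun B U ε α τ) :
    -- (a)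
    ((∃ k, τ.StopsAt (k + 1) ∧ P.IsEpsOptimal ε (τ.best k)) ∨
      ((∀ k, τ.Continues (k + 1)) ∧
        ∀ y, MapClusterPt y atTop τ.best → P.IsEpsOptimal ε y)) ∧
    -- (b)
    ((∀ j k, j ≤ k → P.UpdateStep τ j → τ.Continues k → τ.M k = P.obj (τ.best k)) ∧
      (∀ k, P.UpdateStep τ (k + 1) → P.val < τ.M k →
        (P.obj (τ.best (k + 1)) - P.val) / (τ.M k - P.val) ≤ 1 - 1 / (2 * P.Bprime B + 1)) ∧
      (∀ k, P.UpdateStep τ (k + 1) → τ.M k ≤ P.val → P.obj (τ.best (k + 1)) ≤ P.val)) := by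

  obtain ⟨hne, hval⟩ := hτ.feasible_nonempty_and_val_lt hm hP hU
  refine ⟨?_, fun j k hjk hj hk => hτ.M_eq_obj_best hjk hj hk,
    fun k hk hM => hτ.rate hm hP hB hne hk hM,
    fun k hk hM => hτ.obj_best_le_val hm hP hB hne hk hM⟩
  rcases τ.exists_stopsAt_or_continues with ⟨k, hk⟩ | hcont
  · exact Or.inl ⟨k, hk, hτ.isEpsOptimal_of_stopsAt hm hP hB hne hval hk⟩
  · exact Or.inr ⟨hcont, fun y hy =>
      hτ.isEpsOptimal_of_mapClusterPt hm hP hB hconv hα hne hval hcont hy⟩
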